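/- Identify the circle $S^1=\mathbb{R}/\mathbb{Z}$ with $[0,1)$, with geodesic distance $d(x,y)=\min(|x-y|,1-|x-y|)$, let $\nu$ be the uniform probability measure on $S^1$, and let $W_2^2(\mu,\nu)=\inf_{\gamma}\int d(x,y)^2\,\mathrm{d}\gamma(x,y)$, the infimum being over all couplings $\gamma$ of $\mu$ and $\nu$. For a probability measure $\mu$ on $S^1$ (its moments are automatically finite), let $F_\mu(x)=\mu([0,x])$ for $x\in[0,1)$ be its cumulative distribution function and $F_\mu^{-1}(t)=\inf\{x\in[0,1): F_\mu(x)\ge t\}$, $t\in(0,1)$, its quantile function. Then $W_2(\mu,\nu)$ is finite and $$W_2^2(\mu,\nu)=\int_0^1\big|F_\mu^{-1}(t)-t-\hat\alpha\big|^2\,\mathrm{d}t,\qquad \hat\alpha=\int_{[0,1)}x\,\mathrm{d}\mu(x)-\frac12,$$ where the integrals are of integrable functions. Moreover $\hat\alpha$ is the optimal shift: it is the unique minimizer over $\alpha\in\mathbb{R}$ of $\int_0^1|F_\mu^{-1}(t)-(F_\nu-\alpha)^{-1}(t)|^2\,\mathrm{d}t$, where $F_\nu$ is extended to $\mathbb{R}$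 by $F_\nu(y+1)=F_\nu(y)+1$ and $(F_\nu-\alpha)^{-1}(t)=\inf\{y\in\mathbb{R}: F_\nu(y)-\alpha\ge t\}$. In particular, if $n\ge1$, $0\le x_1<\dots<x_n<1$ and $\mu_n=\frac1n\sum_{i=1}^n\delta_{x_i}$, then $$W_2^2(\mu_n,\nu)=\frac1n\sum_{i=1}^n x_i^2-\Big(\frac1n\sum_{i=1}^n x_i\Big)^2+\frac1{n^2}\sum_{i=1}^n(n+1-2i)\,x_i+\frac1{12}.$$ -/

import Mathlib

open MeasureTheory Set
open scoped ENNReal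

noncomputable section

/-- Couplings of `μ` and `ν`: measures on the product with marginals `μ` and `ν`. -/
def couplings {M : Type*} [MeasurableSpace M] (μ ν : Measure M) : Set (Measure (M × M)) :=
  {γ | γ.map Prod.fst = μ ∧ γ.map Prod.snd = ν}

/-- The `p`-Wasserstein distance
`W_p(μ, ν) = (inf over couplings γ of ∫ d(x,y)^p dγ(x,y))^(1/p)`, with values in `[0, ∞]`. -/
def wassersteinDist {M : Type*} [PseudoEMetricSpace M] [MeasurableSpace M]
    (p : ℝ) (μ ν : Measure M) : ℝ≥0∞ :=
  (⨅ γ ∈ couplings μ ν, ∫⁻ z, edist z.1 z.2 ^ p ∂γ) ^ (1 / p)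

/-- The coordinate in `[0, 1)` of a point of the circle `ℝ / ℤ`. -/
def circleCoord (z : UnitAddCircle) : ℝ := (AddCircle.equivIco (1 : ℝ) 0 z : ℝ)

/-- The cumulative distribution function `F_μ(x) = μ([0, x])` of a measure on the circle,
the circle being identified with `[0, 1)`. -/
def circleCdf (μ : Measure UnitAddCircle) (x : ℝ) : ℝ :=
  μ.real {z | circleCoord z ≤ x}

/-- The quantile function `F_μ⁻¹(t) = inf {x ∈ [0, 1) : t ≤ F_μ(x)}`. For a probability
measure the set is non-empty for every `t < 1`. -/
def circleQuantile (μ : Measure UnitAddCircle) (t : ℝ) : ℝ :=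
  sInf {x | x ∈ Ico (0 : ℝ) 1 ∧ t ≤ circleCdf μ x}

/-- The extension of the cdf to the real line by the convention `F(y + 1) = F(y) + 1`. -/
def circleCdfExt (μ : Measure UnitAddCircle) (y : ℝ) : ℝ :=
  (⌊y⌋ : ℝ) + circleCdf μ (Int.fract y)

/-- The generalized inverse `(F_ν - α)⁻¹(t) = inf {y ∈ ℝ : t ≤ F_ν(y) - α}` of the shifted
extended cdf. -/
def shiftedQuantile (ν : Measure UnitAddCircle) (α t : ℝ) : ℝ :=
  sInf {y : ℝ | t ≤ circleCdfExt ν y - α}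

/-- The quadratic cost of the shift `α`: `∫₀¹ |F_μ⁻¹(t) - (F_ν - α)⁻¹(t)|² dt`. -/
def shiftCost (μ ν : Measure UnitAddCircle) (α : ℝ) : ℝ :=
  ∫ t in (0 : ℝ)..1, |circleQuantile μ t - shiftedQuantile ν α t| ^ 2

/-- The shift `α̂ = ∫ x dμ(x) - 1/2`. -/
def optimalShift (μ : Measure UnitAddCircle) : ℝ :=
  (∫ z, circleCoord z ∂μ) - 1 / 2

/-- The empirical measure `(1/n) ∑ δ_{x_i}` on the circle of the points `x_i` mod 1. -/
def circleEmpirical {n : ℕ} (x : Fin n → ℝ) : Measure UnitAddCircle :=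
  (n : ℝ≥0∞)⁻¹ • ∑ i, Measure.dirac (x i : UnitAddCircle)

end

/-! Write `Q` for the quantile function of `μ` and `β` for `optimalShift μ`. The quantile of the
uniform measure shifted by `α` is `t + α`, so the shift cost is `∫ (Q t - t - α)²`, a quadratic in
`α` minimized at the mean `β` of `Q t - t` (`shiftCost_volume_eq_add_sq`).

Upper bound: for `t` uniform on `(0, 1]`, the pair `(Q t, t + β)` mod 1 is a coupling, and the
circle distance is at most the distance of lifts (`exists_coupling_lintegral_le`).

Lower bound: Kantorovich duality. Extend `Q` to the line by `Q (t + 1) = Q t + 1` and put `ψ t = -2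
∫₀ᵗ (Q s - s - β) ds`. The choice of `β` makes `ψ` periodic (`shiftPotential_periodic`), so it
descends to the circle; monotonicity of `Q` makes `t = s` minimize `(Q s - t - β)² - ψ t` over the
whole line (`sq_sub_shiftPotential_le`). Hence `ψ` and its conjugate attain the dual bound along the
coupling above, and `le_lintegral_of_mem_couplings` integrates this against an arbitrary coupling.

For an empirical measure `Q` is a step function and the integral is computed piece by piece. -/

/-! ### Circle coordinate and distribution function -/

lemma circleCoord_mem_Ico (z : UnitAddCircle) : circleCoord z ∈ Ico (0 : ℝ) 1 := by
  have h := (AddCircle.equivIco (1 : ℝ) 0 z).2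
  simpa [circleCoord] using h

lemma circleCoord_coe {x : ℝ} (hx : x ∈ Ico (0 : ℝ) 1) :
    circleCoord (x : UnitAddCircle) = x :=
  AddCircle.equivIco_coe_of_mem (by simpa using hx)

lemma coe_circleCoord (z : UnitAddCircle) : (circleCoord z : UnitAddCircle) = z :=
  AddCircle.coe_equivIco

lemma measurable_circleCoord : Measurable circleCoord :=
  measurable_subtype_coe.comp (AddCircle.measurableEquivIco (1 : ℝ) 0).measurable

lemma map_coe_map_circleCoord (μ : Measure UnitAddCircle) :
    (μ.map circleCoord).map (fun x : ℝ => (x : UnitAddCircle)) = μ := by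
  rw [Measure.map_map AddCircle.measurable_mk' measurable_circleCoord]
  have : (fun x : ℝ => (x : UnitAddCircle)) ∘ circleCoord = id := funext coe_circleCoord
  rw [this, Measure.map_id]

lemma integrable_circleCoord (μ : Measure UnitAddCircle) [IsFiniteMeasure μ] :
    Integrable circleCoord μ :=
  Integrable.of_bound measurable_circleCoord.aestronglyMeasurable 1
    (.of_forall fun z => by
      rw [Real.norm_eq_abs, abs_of_nonneg (circleCoord_mem_Ico z).1]
      exact (circleCoord_mem_Ico z).2.le)

lemma circleCdf_eq_cdf (μ : Measure UnitAddCircle) [IsProbabilityMeasure μ] (x : ℝ) :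
    circleCdf μ x = ProbabilityTheory.cdf (μ.map circleCoord) x := by
  have : IsProbabilityMeasure (μ.map circleCoord) :=
    Measure.isProbabilityMeasure_map measurable_circleCoord.aemeasurable
  rw [ProbabilityTheory.cdf_eq_real, map_measureReal_apply measurable_circleCoord measurableSet_Iic]
  rfl

lemma circleCdf_mono (μ : Measure UnitAddCircle) [IsProbabilityMeasure μ] :
    Monotone (circleCdf μ) := fun x y h => by
  simpa only [circleCdf_eq_cdf] using ProbabilityTheory.monotone_cdf _ h

lemma circleCdf_of_neg (μ : Measure UnitAddCircle) {x : ℝ} (hx : x < 0) : circleCdf μ x = 0 := by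
  have : {z | circleCoord z ≤ x} = ∅ := by
    ext z
    simpa using hx.trans_le (circleCoord_mem_Ico z).1
  simp [circleCdf, this]

lemma circleCdf_of_one_le (μ : Measure UnitAddCircle) [IsProbabilityMeasure μ] {x : ℝ}
    (hx : 1 ≤ x) : circleCdf μ x = 1 := by
  have : {z | circleCoord z ≤ x} = univ := by
    ext z
    simpa using (circleCoord_mem_Ico z).2.le.trans hx
  simp [circleCdf, this]

lemma circleCdf_mem_Icc (μ : Measure UnitAddCircle) [IsProbabilityMeasure μ] (x : ℝ) :
    circleCdf μ x ∈ Icc (0 : ℝ) 1 :=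
  ⟨measureReal_nonneg, measureReal_le_one⟩

/-- Coordinates are strictly below 1, so the arcs `[0, 1 - 1/(n+1)]` exhaust the circle and their
masses tend to 1. -/
lemma exists_le_circleCdf (μ : Measure UnitAddCircle) [IsProbabilityMeasure μ] {t : ℝ}
    (ht : t < 1) : ∃ x ∈ Ico (0 : ℝ) 1, t ≤ circleCdf μ x := by
  let u : ℕ → ℝ := fun n => 1 - 1 / ((n : ℝ) + 1)
  have hu : Monotone u := fun m n h => by
    have := Nat.one_div_le_one_div (α := ℝ) h
    simp only [u]
    linarith
  have hmono : Monotone fun n : ℕ => {z : UnitAddCircle | circleCoord z ≤ u n} :=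
    fun m n h z (hz : circleCoord z ≤ u m) => hz.trans (hu h)
  have hU : ⋃ n : ℕ, {z : UnitAddCircle | circleCoord z ≤ u n} = univ := by
    ext z
    simp only [mem_iUnion, mem_ofPred_eq, mem_univ, iff_true]
    obtain ⟨n, hn⟩ := exists_nat_one_div_lt (sub_pos.2 (circleCoord_mem_Ico z).2)
    exact ⟨n, by simp only [u]; linarith⟩
  have h := tendsto_measure_iUnion_atTop (μ := μ) hmono
  rw [hU, measure_univ] at h
  have h2 : Filter.Tendsto (fun n : ℕ => circleCdf μ (u n)) Filter.atTop (nhds 1) := by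
    exact (ENNReal.tendsto_toReal ENNReal.one_ne_top).comp h
  obtain ⟨n, hn⟩ := (h2.eventually (lt_mem_nhds ht)).exists
  refine ⟨u n, ⟨?_, ?_⟩, hn.le⟩
  · have : 1 / ((n : ℝ) + 1) ≤ 1 := by
      rw [div_le_one (by positivity)]; linarith [(Nat.cast_nonneg n : (0 : ℝ) ≤ n)]
    simp only [u]; linarith
  · have : 0 < 1 / ((n : ℝ) + 1) := by positivity
    simp only [u]; linarith

/-! ### The quantile function -/

lemma circleQuantile_mem_Icc (μ : Measure UnitAddCircle) (t : ℝ) :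
    circleQuantile μ t ∈ Icc (0 : ℝ) 1 := by
  refine ⟨Real.sInf_nonneg fun x hx => hx.1.1, ?_⟩
  rcases {x | x ∈ Ico (0 : ℝ) 1 ∧ t ≤ circleCdf μ x}.eq_empty_or_nonempty with h | ⟨x, hx⟩
  · rw [circleQuantile, h, Real.sInf_empty]
    exact zero_le_one
  · exact (csInf_le ⟨0, fun y hy => hy.1.1⟩ hx).trans hx.1.2.le

lemma circleQuantile_le {μ : Measure UnitAddCircle} {t x : ℝ} (hx : x ∈ Ico (0 : ℝ) 1)
    (h : t ≤ circleCdf μ x) : circleQuantile μ t ≤ x :=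
  csInf_le ⟨0, fun _ hy => hy.1.1⟩ ⟨hx, h⟩

lemma monotoneOn_circleQuantile (μ : Measure UnitAddCircle) [IsProbabilityMeasure μ] :
    MonotoneOn (circleQuantile μ) (Iio 1) := fun _ _ _ ht hst =>
  le_csInf (exists_le_circleCdf μ ht) fun _ hx => circleQuantile_le hx.1 (hst.trans hx.2)

/-- Right continuity of the distribution function means that the infimum still satisfies the
inequality. -/
lemma circleQuantile_le_iff (μ : Measure UnitAddCircle) [IsProbabilityMeasure μ] {t : ℝ}
    (ht : t ∈ Ioo (0 : ℝ) 1) (x : ℝ) : circleQuantile μ t ≤ x ↔ t ≤ circleCdf μ x := by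
  rcases lt_or_ge x 0 with hx0 | hx0
  · rw [circleCdf_of_neg μ hx0]
    exact iff_of_false (hx0.trans_le (circleQuantile_mem_Icc μ t).1).not_ge ht.1.not_ge
  rcases lt_or_ge x 1 with hx1 | hx1
  · refine ⟨fun h => ?_, circleQuantile_le ⟨hx0, hx1⟩⟩
    have hF : ContinuousWithinAt (circleCdf μ) (Ioi x) x := by
      have h1 := (ProbabilityTheory.cdf (μ.map circleCoord)).right_continuous x
      rw [funext (circleCdf_eq_cdf μ)]
      exact h1.mono Ioi_subset_Ici_self
    refine ge_of_tendsto hF (Filter.eventually_of_mem self_mem_nhdsWithin fun y hy => ?_)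
    obtain ⟨z, hz, hzy⟩ := exists_lt_of_csInf_lt (exists_le_circleCdf μ ht.2) (h.trans_lt hy)
    exact hz.2.trans (circleCdf_mono μ hzy.le)
  · rw [circleCdf_of_one_le μ hx1]
    exact iff_of_true ((circleQuantile_mem_Icc μ t).2.trans hx1) ht.2.le

lemma aemeasurable_circleQuantile (μ : Measure UnitAddCircle) [IsProbabilityMeasure μ] :
    AEMeasurable (circleQuantile μ) (volume.restrict (Ioc 0 1)) := by
  -- The endpoint `t = 1` is dropped: there the defining set may be empty, `sInf` is then 0, and
  -- monotonicity can fail.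
  rw [Measure.restrict_congr_set Ioo_ae_eq_Ioc.symm]
  exact aemeasurable_restrict_of_monotoneOn measurableSet_Ioo
    ((monotoneOn_circleQuantile μ).mono Ioo_subset_Iio_self)

instance isProbabilityMeasure_restrict_Ioc_zero_one :
    IsProbabilityMeasure ((volume : Measure ℝ).restrict (Ioc 0 1)) := ⟨by simp⟩

lemma map_circleQuantile (μ : Measure UnitAddCircle) [IsProbabilityMeasure μ] :
    (volume.restrict (Ioc 0 1)).map (circleQuantile μ) = μ.map circleCoord := by
  have := Measure.isProbabilityMeasure_map (aemeasurable_circleQuantile μ)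
  refine Measure.ext_of_Iic _ _ fun x => ?_
  rw [Measure.map_apply_of_aemeasurable (aemeasurable_circleQuantile μ) measurableSet_Iic,
    Measure.map_apply measurable_circleCoord measurableSet_Iic,
    Measure.restrict_congr_set Ioo_ae_eq_Ioc.symm, Measure.restrict_apply' measurableSet_Ioo]
  have h1 : circleQuantile μ ⁻¹' Iic x ∩ Ioo 0 1 = Iic (circleCdf μ x) ∩ Ioo 0 1 := by
    ext t
    exact and_congr_left fun ht => circleQuantile_le_iff μ ht x
  have h2 : (volume : Measure ℝ) (Iic (circleCdf μ x) ∩ Ioo 0 1) =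
      volume (Ioc 0 (circleCdf μ x)) := by
    rw [← Measure.restrict_apply' measurableSet_Ioo, Measure.restrict_congr_set Ioo_ae_eq_Ioc,
      Measure.restrict_apply' measurableSet_Ioc]
    congr 1
    ext t
    simp only [mem_inter_iff, mem_Iic, mem_Ioc]
    exact ⟨fun h => ⟨h.2.1, h.1⟩, fun h => ⟨h.2, h.1, h.2.trans (circleCdf_mem_Icc μ x).2⟩⟩
  rw [h1, h2, Real.volume_Ioc, sub_zero]
  exact ofReal_measureReal

lemma map_coe_circleQuantile (μ : Measure UnitAddCircle) [IsProbabilityMeasure μ] :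
    (volume.restrict (Ioc 0 1)).map (fun t => (circleQuantile μ t : UnitAddCircle)) = μ := by
  conv_rhs => rw [← map_coe_map_circleCoord μ, ← map_circleQuantile μ]
  exact (AEMeasurable.map_map_of_aemeasurable AddCircle.measurable_mk'.aemeasurable
    (aemeasurable_circleQuantile μ)).symm

lemma intervalIntegrable_circleQuantile (μ : Measure UnitAddCircle) [IsProbabilityMeasure μ] :
    IntervalIntegrable (circleQuantile μ) volume 0 1 := by
  rw [intervalIntegrable_iff_integrableOn_Ioc_of_le zero_le_one]
  refine Integrable.of_bound (aemeasurable_circleQuantile μ).aestronglyMeasurable 1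
    (.of_forall fun t => ?_)
  rw [Real.norm_eq_abs, abs_of_nonneg (circleQuantile_mem_Icc μ t).1]
  exact (circleQuantile_mem_Icc μ t).2

lemma intervalIntegrable_abs_circleQuantile_sub_sq (μ : Measure UnitAddCircle)
    [IsProbabilityMeasure μ] (α : ℝ) :
    IntervalIntegrable (fun t => |circleQuantile μ t - t - α| ^ 2) volume 0 1 := by
  rw [intervalIntegrable_iff_integrableOn_Ioc_of_le zero_le_one]
  refine Integrable.of_bound (C := (2 + |α|) ^ 2) ?_ ?_
  · have := aemeasurable_circleQuantile μ
    have h : AEMeasurable (fun t => (circleQuantile μ t - t - α) ^ 2)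
      (volume.restrict (Ioc 0 1)) := by fun_prop
    simpa only [sq_abs] using h.aestronglyMeasurable
  · filter_upwards [ae_restrict_mem measurableSet_Ioc] with t ht
    have hQ := circleQuantile_mem_Icc μ t
    rw [Real.norm_eq_abs, abs_pow, abs_abs]
    refine pow_le_pow_left₀ (abs_nonneg _) ?_ 2
    rw [abs_le]
    constructor <;> linarith [neg_abs_le α, le_abs_self α, hQ.1, hQ.2, ht.1, ht.2]

lemma integral_circleQuantile (μ : Measure UnitAddCircle) [IsProbabilityMeasure μ] :
    ∫ t in (0 : ℝ)..1, circleQuantile μ t = optimalShift μ + 1 / 2 := by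
  have h1 := integral_map (μ := μ) measurable_circleCoord.aemeasurable
    (f := fun x : ℝ => x) aestronglyMeasurable_id
  have h2 := integral_map (aemeasurable_circleQuantile μ)
    (f := fun x : ℝ => x) aestronglyMeasurable_id
  rw [map_circleQuantile, h1] at h2
  rw [intervalIntegral.integral_of_le zero_le_one, optimalShift, h2]
  ring

/-! ### The uniform measure and the cost of a shift -/

lemma circleCdf_volume {x : ℝ} (hx : x ∈ Ico (0 : ℝ) 1) :
    circleCdf (volume : Measure UnitAddCircle) x = x := by
  have hm : MeasurableSet {z : UnitAddCircle | circleCoord z ≤ x} :=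
    measurable_circleCoord measurableSet_Iic
  rw [circleCdf, measureReal_def,
    ← (UnitAddCircle.measurePreserving_mk 0).measure_preimage hm.nullMeasurableSet, zero_add,
    Measure.restrict_congr_set Ioo_ae_eq_Ioc.symm, Measure.restrict_apply' measurableSet_Ioo]
  have h1 : (fun y : ℝ => (y : UnitAddCircle)) ⁻¹' {z | circleCoord z ≤ x} ∩ Ioo 0 1 =
      Ioc 0 x := by
    ext y
    simp only [mem_inter_iff, mem_preimage, mem_ofPred_eq, mem_Ioc]
    constructor
    · rintro ⟨h, hy⟩
      rw [circleCoord_coe ⟨hy.1.le, hy.2⟩] at h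
      exact ⟨hy.1, h⟩
    · rintro ⟨h, hy⟩
      have hy1 := hy.trans_lt hx.2
      exact ⟨by rwa [circleCoord_coe ⟨h.le, hy1⟩], h, hy1⟩
  rw [h1, Real.volume_Ioc, sub_zero, ENNReal.toReal_ofReal hx.1]

lemma circleCdfExt_volume (y : ℝ) : circleCdfExt (volume : Measure UnitAddCircle) y = y := by
  rw [circleCdfExt, circleCdf_volume ⟨Int.fract_nonneg y, Int.fract_lt_one y⟩,
    Int.floor_add_fract]

lemma shiftedQuantile_volume (α t : ℝ) :
    shiftedQuantile (volume : Measure UnitAddCircle) α t = t + α := by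
  have : {y : ℝ | t ≤ circleCdfExt volume y - α} = Ici (t + α) := by
    ext y
    simp [circleCdfExt_volume, le_sub_iff_add_le]
  rw [shiftedQuantile, this, csInf_Ici]

lemma shiftCost_volume (μ : Measure UnitAddCircle) (α : ℝ) :
    shiftCost μ volume α = ∫ t in (0 : ℝ)..1, |circleQuantile μ t - t - α| ^ 2 := by
  simp only [shiftCost, shiftedQuantile_volume, sub_sub]

lemma integral_circleQuantile_sub_sub (μ : Measure UnitAddCircle) [IsProbabilityMeasure μ] :
    ∫ t in (0 : ℝ)..1, (circleQuantile μ t - t - optimalShift μ) = 0 := by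
  have hQ := intervalIntegrable_circleQuantile μ
  have hid : IntervalIntegrable (fun t : ℝ => t) volume 0 1 := intervalIntegral.intervalIntegrable_id
  rw [intervalIntegral.integral_sub (hQ.sub hid) (by simp), intervalIntegral.integral_sub hQ hid,
    integral_circleQuantile, integral_id]
  simp

/-- Expanding the square around the mean, the cross term integrates to zero. -/
lemma shiftCost_volume_eq_add_sq (μ : Measure UnitAddCircle) [IsProbabilityMeasure μ] (α : ℝ) :
    shiftCost μ volume α = shiftCost μ volume (optimalShift μ) + (α - optimalShift μ) ^ 2 := by
  rw [shiftCost_volume, shiftCost_volume]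
  set β := optimalShift μ
  have hQ := intervalIntegrable_circleQuantile μ
  have hid : IntervalIntegrable (fun t : ℝ => t) volume 0 1 := intervalIntegral.intervalIntegrable_id
  have hlin : IntervalIntegrable (fun t => circleQuantile μ t - t - β) volume 0 1 :=
    (hQ.sub hid).sub (by simp)
  have h : ∀ t, |circleQuantile μ t - t - α| ^ 2 = |circleQuantile μ t - t - β| ^ 2
      + (2 * (β - α)) * (circleQuantile μ t - t - β) + (α - β) ^ 2 := fun t => by
    simp only [sq_abs]; ring
  simp only [h]
  rw [intervalIntegral.integral_add
      ((intervalIntegrable_abs_circleQuantile_sub_sq μ β).add (hlin.const_mul _)) (by simp),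
    intervalIntegral.integral_add (intervalIntegrable_abs_circleQuantile_sub_sq μ β)
      (hlin.const_mul _), intervalIntegral.integral_const_mul, integral_circleQuantile_sub_sub]
  simp

lemma shiftCost_optimalShift_lt (μ : Measure UnitAddCircle) [IsProbabilityMeasure μ] {α : ℝ}
    (hα : α ≠ optimalShift μ) : shiftCost μ volume (optimalShift μ) < shiftCost μ volume α := by
  rw [shiftCost_volume_eq_add_sq μ α]
  have : 0 < (α - optimalShift μ) ^ 2 := by
    have := sub_ne_zero.2 hα
    positivity
  linarith

/-! ### Kantorovich potentials -/

/-- The extension of the quantile function to the real line with `Q (t + 1) = Q t + 1`. -/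
noncomputable def circleQuantileExt (μ : Measure UnitAddCircle) (t : ℝ) : ℝ :=
  (⌊t⌋ : ℝ) + circleQuantile μ (Int.fract t)

lemma circleQuantileExt_add_one (μ : Measure UnitAddCircle) (t : ℝ) :
    circleQuantileExt μ (t + 1) = circleQuantileExt μ t + 1 := by
  simp only [circleQuantileExt, Int.floor_add_one, Int.fract_add_one]
  push_cast
  ring

lemma circleQuantileExt_of_mem_Ico (μ : Measure UnitAddCircle) {t : ℝ} (ht : t ∈ Ico (0 : ℝ) 1) :
    circleQuantileExt μ t = circleQuantile μ t := by
  rw [circleQuantileExt, Int.floor_eq_zero_iff.2 ht, Int.fract_eq_self.2 ht]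
  simp

lemma monotone_circleQuantileExt (μ : Measure UnitAddCircle) [IsProbabilityMeasure μ] :
    Monotone (circleQuantileExt μ) := fun s t hst => by
  rw [circleQuantileExt, circleQuantileExt]
  rcases (Int.floor_mono hst).eq_or_lt with h | h
  · have hf : Int.fract s ≤ Int.fract t := by
      rw [Int.fract, Int.fract, h]
      linarith
    have := monotoneOn_circleQuantile μ (Int.fract_lt_one s) (Int.fract_lt_one t) hf
    rw [h]
    linarith
  · have h1 : (⌊s⌋ : ℝ) + 1 ≤ ⌊t⌋ := by exact_mod_cast h
    linarith [(circleQuantile_mem_Icc μ (Int.fract s)).2,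
      (circleQuantile_mem_Icc μ (Int.fract t)).1]

lemma intervalIntegrable_circleQuantileExt_sub_sub (μ : Measure UnitAddCircle)
    [IsProbabilityMeasure μ] (β a b : ℝ) :
    IntervalIntegrable (fun t => circleQuantileExt μ t - t - β) volume a b :=
  ((monotone_circleQuantileExt μ).intervalIntegrable.sub intervalIntegral.intervalIntegrable_id).sub
    intervalIntegrable_const

/-- The tangent-line inequality for the convex primitive of `f`; no order between `a` and `b` is
assumed. -/
lemma Monotone.mul_sub_le_integral {f : ℝ → ℝ} (hf : Monotone f) (a b : ℝ) :
    f a * (b - a) ≤ ∫ x in a..b, f x := by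
  have hc : ∫ _ in a..b, f a = f a * (b - a) := by
    rw [intervalIntegral.integral_const, smul_eq_mul, mul_comm]
  rw [← hc]
  rcases le_total a b with h | h
  · exact intervalIntegral.integral_mono_on h (by simp) hf.intervalIntegrable fun x hx => hf hx.1
  · rw [intervalIntegral.integral_symm b a, intervalIntegral.integral_symm b a]
    exact neg_le_neg (intervalIntegral.integral_mono_on h hf.intervalIntegrable (by simp)
      fun x hx => hf hx.2)

/-- The Kantorovich potential on the real line, in the coordinate of the optimally shifted
uniform measure. -/
noncomputable def shiftPotential (μ : Measure UnitAddCircle) (t : ℝ) : ℝ :=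
  -2 * ∫ s in (0 : ℝ)..t, (circleQuantileExt μ s - s - optimalShift μ)

lemma continuous_shiftPotential (μ : Measure UnitAddCircle) [IsProbabilityMeasure μ] :
    Continuous (shiftPotential μ) :=
  (intervalIntegral.continuous_primitive
    (intervalIntegrable_circleQuantileExt_sub_sub μ (optimalShift μ)) 0).const_mul _

/-- The integrand is periodic with mean zero over a period. This is where the duality argument needs
the particular value of the shift. -/
lemma shiftPotential_periodic (μ : Measure UnitAddCircle) [IsProbabilityMeasure μ] :
    Function.Periodic (shiftPotential μ) 1 := fun t => by
  have hint := intervalIntegrable_circleQuantileExt_sub_sub μ (optimalShift μ)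
  have hp : Function.Periodic (fun s => circleQuantileExt μ s - s - optimalShift μ) 1 := fun s => by
    simp only [circleQuantileExt_add_one]
    ring
  have h0 : ∫ s in t..t + 1, (circleQuantileExt μ s - s - optimalShift μ) = 0 := by
    rw [hp.intervalIntegral_add_eq t 0, zero_add]
    refine (intervalIntegral.integral_congr_Ioo_of_le zero_le_one fun s hs => ?_).trans
      (integral_circleQuantile_sub_sub μ)
    simp only [circleQuantileExt_of_mem_Ico μ ⟨hs.1.le, hs.2⟩]
  rw [shiftPotential, shiftPotential,
    ← intervalIntegral.integral_add_adjacent_intervals (hint 0 t) (hint t (t + 1)), h0, add_zero]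

/-- The right side minus the left side is `2 ∫ r in s..t, (Q r - Q s)` with `Q` the extended
quantile, nonnegative by monotonicity for either order of `s` and `t`. -/
lemma sq_sub_shiftPotential_le (μ : Measure UnitAddCircle) [IsProbabilityMeasure μ] (s t : ℝ) :
    (circleQuantileExt μ s - (s + optimalShift μ)) ^ 2 - shiftPotential μ s ≤
      (circleQuantileExt μ s - (t + optimalShift μ)) ^ 2 - shiftPotential μ t := by
  have hint := intervalIntegrable_circleQuantileExt_sub_sub μ (optimalShift μ)
  have h1 : shiftPotential μ t = shiftPotential μ s -
      2 * ∫ r in s..t, (circleQuantileExt μ r - r - optimalShift μ) := by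
    rw [shiftPotential, shiftPotential,
      ← intervalIntegral.integral_add_adjacent_intervals (hint 0 s) (hint s t)]
    ring
  have hm := monotone_circleQuantileExt μ
  have hid : IntervalIntegrable (fun r : ℝ => r) volume s t := intervalIntegral.intervalIntegrable_id
  have h2 := hm.mul_sub_le_integral s t
  rw [h1, intervalIntegral.integral_sub (hm.intervalIntegrable.sub hid) (by simp),
    intervalIntegral.integral_sub hm.intervalIntegrable hid, integral_id,
    intervalIntegral.integral_const, smul_eq_mul]
  nlinarith [h2]

/-- The Kantorovich potential of the uniform measure on the circle. -/
noncomputable def uniformPotential (μ : Measure UnitAddCircle) [IsProbabilityMeasure μ]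
    (y : UnitAddCircle) : ℝ :=
  (shiftPotential_periodic μ).lift (y - (optimalShift μ : UnitAddCircle))

lemma uniformPotential_coe (μ : Measure UnitAddCircle) [IsProbabilityMeasure μ] (y : ℝ) :
    uniformPotential μ y = shiftPotential μ (y - optimalShift μ) := rfl

lemma continuous_uniformPotential (μ : Measure UnitAddCircle) [IsProbabilityMeasure μ] :
    Continuous (uniformPotential μ) := by
  have h : Continuous ((shiftPotential_periodic μ).lift : UnitAddCircle → ℝ) :=
    continuous_coinduced_dom.2 (continuous_shiftPotential μ)
  exact h.comp (continuous_id.sub continuous_const)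

/-- The conjugate of `uniformPotential` for the squared distance. -/
noncomputable def conjugatePotential (μ : Measure UnitAddCircle) [IsProbabilityMeasure μ]
    (x : UnitAddCircle) : ℝ :=
  ⨅ y : UnitAddCircle, (dist x y ^ 2 - uniformPotential μ y)

lemma bddBelow_range_dist_sq_sub (μ : Measure UnitAddCircle) [IsProbabilityMeasure μ]
    (x : UnitAddCircle) : BddBelow (range fun y => dist x y ^ 2 - uniformPotential μ y) := by
  have hc : Continuous fun y => dist x y ^ 2 - uniformPotential μ y :=
    ((continuous_const.dist continuous_id).pow 2).sub (continuous_uniformPotential μ)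
  exact (isCompact_range hc).bddBelow

lemma conjugatePotential_add_le (μ : Measure UnitAddCircle) [IsProbabilityMeasure μ]
    (x y : UnitAddCircle) : conjugatePotential μ x + uniformPotential μ y ≤ dist x y ^ 2 := by
  have := ciInf_le (bddBelow_range_dist_sq_sub μ x) y
  rw [conjugatePotential]
  linarith

lemma UnitAddCircle.dist_le_half (x y : UnitAddCircle) : dist x y ≤ 1 / 2 := by
  rw [dist_eq_norm]
  simpa using AddCircle.norm_le_half_period (1 : ℝ) (x := x - y) one_ne_zero

/-- Distances on the circle are at most 1/2, so `dist · y ^ 2` is 1-Lipschitz for each `y`, and so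
is the infimum. Only the resulting continuity is used, for integrability. -/
lemma lipschitzWith_conjugatePotential (μ : Measure UnitAddCircle) [IsProbabilityMeasure μ] :
    LipschitzWith 1 (conjugatePotential μ) := by
  refine LipschitzWith.of_le_add fun x x' => ?_
  rw [← sub_le_iff_le_add]
  refine le_ciInf fun y => ?_
  have h1 := conjugatePotential_add_le μ x y
  have h2 := dist_triangle x x' y
  have h3 := UnitAddCircle.dist_le_half x y
  have h4 := UnitAddCircle.dist_le_half x' y
  have h5 : dist x y ^ 2 - dist x' y ^ 2 ≤ dist x x' := by
    have : (dist x y - dist x' y) * (dist x y + dist x' y) ≤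
        dist x x' * (dist x y + dist x' y) := by gcongr; linarith
    nlinarith [dist_nonneg (x := x) (y := x')]
  linarith

lemma UnitAddCircle.edist_coe_le (x y : ℝ) :
    edist (x : UnitAddCircle) (y : UnitAddCircle) ≤ ENNReal.ofReal |x - y| := by
  rw [edist_dist, dist_eq_norm, ← AddCircle.coe_sub]
  refine ENNReal.ofReal_le_ofReal ?_
  simpa using QuotientAddGroup.norm_mk_le_norm (S := AddSubgroup.zmultiples (1 : ℝ)) (m := x - y)

lemma UnitAddCircle.exists_dist_eq (x : ℝ) (y : UnitAddCircle) :
    ∃ r : ℝ, (r : UnitAddCircle) = y ∧ dist (x : UnitAddCircle) y = |x - r| := by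
  obtain ⟨r, rfl⟩ := QuotientAddGroup.mk_surjective y
  -- The lift of `y` nearest to `x`.
  refine ⟨r + round (x - r), ?_, ?_⟩
  · have : ((round (x - r) : ℝ) : UnitAddCircle) = 0 :=
      (AddCircle.coe_eq_zero_iff (1 : ℝ)).2 ⟨round (x - r), by simp⟩
    rw [AddCircle.coe_add, this, add_zero]
  · rw [dist_eq_norm]
    change ‖((x - r : ℝ) : UnitAddCircle)‖ = _
    rw [UnitAddCircle.norm_eq, sub_add_eq_sub_sub]

/-- Replacing each competitor `y` by its lift nearest to the quantile reduces the infimum over the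
circle to the minimization on the line. -/
lemma le_conjugatePotential_circleQuantile (μ : Measure UnitAddCircle) [IsProbabilityMeasure μ]
    {t : ℝ} (ht : t ∈ Ico (0 : ℝ) 1) :
    |circleQuantile μ t - t - optimalShift μ| ^ 2 ≤
      conjugatePotential μ (circleQuantile μ t) +
        uniformPotential μ ((t + optimalShift μ : ℝ) : UnitAddCircle) := by
  rw [← sub_le_iff_le_add]
  refine le_ciInf fun y => ?_
  obtain ⟨r, rfl, hr⟩ := UnitAddCircle.exists_dist_eq (circleQuantile μ t) y
  have h := sq_sub_shiftPotential_le μ t (r - optimalShift μ)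
  rw [circleQuantileExt_of_mem_Ico μ ht, sub_add_cancel, ← sub_sub] at h
  rw [hr, uniformPotential_coe, uniformPotential_coe, add_sub_cancel_right, sq_abs, sq_abs]
  exact h

/-! ### The optimal coupling and weak duality -/

lemma map_coe_add_const (β : ℝ) :
    (volume.restrict (Ioc 0 1)).map (fun t : ℝ => ((t + β : ℝ) : UnitAddCircle)) = volume := by
  have h0 := UnitAddCircle.measurePreserving_mk 0
  rw [zero_add] at h0
  exact ((measurePreserving_add_right volume (β : UnitAddCircle)).comp h0).map_eq

lemma exists_coupling_lintegral_le (μ : Measure UnitAddCircle) [IsProbabilityMeasure μ] (β : ℝ) :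
    ∃ γ ∈ couplings μ (volume : Measure UnitAddCircle), ∫⁻ z, edist z.1 z.2 ^ (2 : ℝ) ∂γ ≤
      ENNReal.ofReal (∫ t in (0 : ℝ)..1, |circleQuantile μ t - t - β| ^ 2) := by
  have hQ : AEMeasurable (fun t => (circleQuantile μ t : UnitAddCircle))
      (volume.restrict (Ioc 0 1)) :=
    AddCircle.measurable_mk'.comp_aemeasurable (aemeasurable_circleQuantile μ)
  have hT : Measurable fun t : ℝ => ((t + β : ℝ) : UnitAddCircle) :=
    AddCircle.measurable_mk'.comp (measurable_id.add_const β)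
  have hQT := hQ.prodMk hT.aemeasurable
  refine ⟨(volume.restrict (Ioc 0 1)).map fun t : ℝ =>
    ((circleQuantile μ t : UnitAddCircle), ((t + β : ℝ) : UnitAddCircle)), ⟨?_, ?_⟩, ?_⟩
  · rw [AEMeasurable.map_map_of_aemeasurable measurable_fst.aemeasurable hQT]
    exact map_coe_circleQuantile μ
  · rw [AEMeasurable.map_map_of_aemeasurable measurable_snd.aemeasurable hQT]
    exact map_coe_add_const β
  · have hint := (intervalIntegrable_iff_integrableOn_Ioc_of_le zero_le_one).1
      (intervalIntegrable_abs_circleQuantile_sub_sq μ β)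
    rw [lintegral_map' (by fun_prop) hQT, intervalIntegral.integral_of_le zero_le_one,
      ofReal_integral_eq_lintegral_ofReal hint (.of_forall fun t => by positivity)]
    refine lintegral_mono fun t => ?_
    rw [ENNReal.rpow_two, sub_sub, ENNReal.ofReal_pow (abs_nonneg _)]
    gcongr
    exact UnitAddCircle.edist_coe_le _ _

/-- The integral of a sum of potentials depends only on the marginals, so it can be moved from the
quantile coupling, where it dominates the cost, to `γ`, where the cost dominates it. -/
lemma le_lintegral_of_mem_couplings (μ : Measure UnitAddCircle) [IsProbabilityMeasure μ]
    {γ : Measure (UnitAddCircle × UnitAddCircle)}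
    (hγ : γ ∈ couplings μ (volume : Measure UnitAddCircle)) :
    ENNReal.ofReal (∫ t in (0 : ℝ)..1, |circleQuantile μ t - t - optimalShift μ| ^ 2) ≤
      ∫⁻ z, edist z.1 z.2 ^ (2 : ℝ) ∂γ := by
  obtain ⟨h1, h2⟩ := hγ
  have hγp : IsProbabilityMeasure γ := by
    refine ⟨?_⟩
    rw [← preimage_univ (f := Prod.fst), ← Measure.map_apply measurable_fst .univ, h1, measure_univ]
  have hφ : Continuous (conjugatePotential μ) := (lipschitzWith_conjugatePotential μ).continuous
  have hψ := continuous_uniformPotential μ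
  have hint {X : Type} [TopologicalSpace X] [CompactSpace X] [T2Space X] [MeasurableSpace X]
      [OpensMeasurableSpace X] [SecondCountableTopology X] {m : Measure X} [IsFiniteMeasure m]
      {f : X → ℝ} (hf : Continuous f) : Integrable f m := by
    rw [← integrableOn_univ]
    exact hf.continuousOn.integrableOn_compact isCompact_univ
  have hQ : AEMeasurable (fun t => (circleQuantile μ t : UnitAddCircle))
      (volume.restrict (Ioc 0 1)) :=
    AddCircle.measurable_mk'.comp_aemeasurable (aemeasurable_circleQuantile μ)
  have hT : Measurable fun t : ℝ => ((t + optimalShift μ : ℝ) : UnitAddCircle) :=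
    AddCircle.measurable_mk'.comp (measurable_id.add_const _)
  have hφQ : Integrable (fun t => conjugatePotential μ (circleQuantile μ t))
      (volume.restrict (Ioc 0 1)) := by
    refine Integrable.comp_aemeasurable (g := conjugatePotential μ) ?_ hQ
    rw [map_coe_circleQuantile]
    exact hint hφ
  have hψT : Integrable
      (fun t => uniformPotential μ ((t + optimalShift μ : ℝ) : UnitAddCircle))
      (volume.restrict (Ioc 0 1)) := by
    refine Integrable.comp_aemeasurable (g := uniformPotential μ) ?_ hT.aemeasurable
    rw [map_coe_add_const]
    exact hint hψ
  have hφm : ∫ z, conjugatePotential μ z.1 ∂γ =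
      ∫ t in Ioc (0 : ℝ) 1, conjugatePotential μ (circleQuantile μ t) := by
    rw [← integral_map hQ hφ.aestronglyMeasurable, map_coe_circleQuantile,
      ← integral_map measurable_fst.aemeasurable hφ.aestronglyMeasurable, h1]
  have hψm : ∫ z, uniformPotential μ z.2 ∂γ =
      ∫ t in Ioc (0 : ℝ) 1, uniformPotential μ ((t + optimalShift μ : ℝ) : UnitAddCircle) := by
    rw [← integral_map hT.aemeasurable hψ.aestronglyMeasurable, map_coe_add_const,
      ← integral_map measurable_snd.aemeasurable hψ.aestronglyMeasurable, h2]
  have hd : Continuous fun z : UnitAddCircle × UnitAddCircle => dist z.1 z.2 ^ 2 :=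
    continuous_dist.pow 2
  have hlint : ∫⁻ z, edist z.1 z.2 ^ (2 : ℝ) ∂γ = ENNReal.ofReal (∫ z, dist z.1 z.2 ^ 2 ∂γ) := by
    rw [ofReal_integral_eq_lintegral_ofReal (hint hd) (.of_forall fun z => by positivity)]
    refine lintegral_congr fun z => ?_
    rw [edist_dist, ENNReal.rpow_two, ENNReal.ofReal_pow dist_nonneg]
  rw [hlint]
  refine ENNReal.ofReal_le_ofReal ?_
  calc ∫ t in (0 : ℝ)..1, |circleQuantile μ t - t - optimalShift μ| ^ 2
      = ∫ t in Ioo (0 : ℝ) 1, |circleQuantile μ t - t - optimalShift μ| ^ 2 := by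
        rw [intervalIntegral.integral_of_le zero_le_one, integral_Ioc_eq_integral_Ioo]
    _ ≤ ∫ t in Ioo (0 : ℝ) 1, (conjugatePotential μ (circleQuantile μ t) +
          uniformPotential μ ((t + optimalShift μ : ℝ) : UnitAddCircle)) := by
        refine setIntegral_mono_on ?_ ?_ measurableSet_Ioo fun t ht =>
          le_conjugatePotential_circleQuantile μ ⟨ht.1.le, ht.2⟩
        · exact ((intervalIntegrable_iff_integrableOn_Ioc_of_le zero_le_one).1
            (intervalIntegrable_abs_circleQuantile_sub_sq μ _)).mono_set Ioo_subset_Ioc_self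
        · exact IntegrableOn.mono_set (hφQ.add hψT) Ioo_subset_Ioc_self
    _ = ∫ z, (conjugatePotential μ z.1 + uniformPotential μ z.2) ∂γ := by
        rw [← integral_Ioc_eq_integral_Ioo, integral_add hφQ hψT,
          integral_add (f := fun z : UnitAddCircle × UnitAddCircle => conjugatePotential μ z.1)
            (g := fun z => uniformPotential μ z.2) (hint (hφ.comp continuous_fst))
            (hint (hψ.comp continuous_snd)), hφm, hψm]
    _ ≤ ∫ z, dist z.1 z.2 ^ 2 ∂γ :=
        integral_mono (hint ((hφ.comp continuous_fst).add (hψ.comp continuous_snd))) (hint hd)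
          fun z => conjugatePotential_add_le μ z.1 z.2

lemma wassersteinDist_two_volume (μ : Measure UnitAddCircle) [IsProbabilityMeasure μ] :
    wassersteinDist 2 μ (volume : Measure UnitAddCircle) =
      ENNReal.ofReal (∫ t in (0 : ℝ)..1,
        |circleQuantile μ t - t - optimalShift μ| ^ 2) ^ (1 / 2 : ℝ) := by
  rw [wassersteinDist]
  congr 1
  refine le_antisymm ?_ (le_iInf₂ fun γ hγ => le_lintegral_of_mem_couplings μ hγ)
  obtain ⟨γ, hγ, hle⟩ := exists_coupling_lintegral_le μ (optimalShift μ)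
  exact (iInf₂_le γ hγ).trans hle

lemma wassersteinDist_two_volume_ne_top (μ : Measure UnitAddCircle) [IsProbabilityMeasure μ] :
    wassersteinDist 2 μ (volume : Measure UnitAddCircle) ≠ ∞ := by
  rw [wassersteinDist_two_volume]
  exact ENNReal.rpow_ne_top_of_nonneg (by norm_num) ENNReal.ofReal_ne_top

lemma toReal_wassersteinDist_two_volume_sq (μ : Measure UnitAddCircle) [IsProbabilityMeasure μ] :
    (wassersteinDist 2 μ (volume : Measure UnitAddCircle)).toReal ^ 2 =
      ∫ t in (0 : ℝ)..1, |circleQuantile μ t - t - optimalShift μ| ^ 2 := by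
  rw [wassersteinDist_two_volume, ← ENNReal.toReal_pow, ← ENNReal.rpow_two, ← ENNReal.rpow_mul]
  norm_num
  exact intervalIntegral.integral_nonneg zero_le_one fun t _ => sq_nonneg _

/-! ### Empirical measures -/

lemma isProbabilityMeasure_circleEmpirical {n : ℕ} (hn : 1 ≤ n) (x : Fin n → ℝ) :
    IsProbabilityMeasure (circleEmpirical x) := by
  refine ⟨?_⟩
  simp only [circleEmpirical, Measure.smul_apply, Measure.finsetSum_apply, measure_univ, smul_eq_mul]
  simp only [Finset.sum_const, Finset.card_univ, Fintype.card_fin, nsmul_eq_mul, mul_one]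
  exact ENNReal.inv_mul_cancel (by exact_mod_cast (by omega)) (ENNReal.natCast_ne_top n)

lemma circleCdf_circleEmpirical {n : ℕ} {x : Fin n → ℝ} (hx : ∀ i, x i ∈ Ico (0 : ℝ) 1) (y : ℝ) :
    circleCdf (circleEmpirical x) y = (Finset.univ.filter fun i => x i ≤ y).card / (n : ℝ) := by
  have hm : MeasurableSet {z : UnitAddCircle | circleCoord z ≤ y} :=
    measurable_circleCoord measurableSet_Iic
  have h : ∀ i, Measure.dirac (x i : UnitAddCircle) {z : UnitAddCircle | circleCoord z ≤ y} =
      if x i ≤ y then 1 else 0 := fun i => by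
    rw [Measure.dirac_apply' _ hm, indicator_apply]
    simp only [mem_ofPred_eq, circleCoord_coe (hx i), Pi.one_apply]
  rw [circleCdf, measureReal_def, circleEmpirical, Measure.smul_apply, Measure.finsetSum_apply]
  simp only [h, smul_eq_mul, Finset.sum_boole, ENNReal.toReal_mul, ENNReal.toReal_inv,
    ENNReal.toReal_natCast]
  rw [div_eq_inv_mul]

/-- The distribution function reaches `(i + 1) / n` at `x i` and is at most `i / n` before it, hence
an interval open on the left and closed on the right. -/
lemma circleQuantile_circleEmpirical {n : ℕ} {x : Fin n → ℝ} (hx : ∀ i, x i ∈ Ico (0 : ℝ) 1)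
    (hmono : StrictMono x) (i : Fin n) {t : ℝ}
    (ht : t ∈ Ioc ((i : ℝ) / n) (((i : ℝ) + 1) / n)) :
    circleQuantile (circleEmpirical x) t = x i := by
  have hn : (0 : ℝ) < n := by exact_mod_cast i.pos
  refine IsLeast.csInf_eq ⟨⟨hx i, ?_⟩, ?_⟩
  · rw [circleCdf_circleEmpirical hx]
    refine ht.2.trans ?_
    have h : (Finset.univ.filter fun j => x j ≤ x i) = Finset.Iic i := by
      ext j
      simp [hmono.le_iff_le]
    rw [h, Fin.card_Iic]
    push_cast
    exact le_rfl
  · rintro y ⟨-, hy⟩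
    by_contra! hlt
    rw [circleCdf_circleEmpirical hx] at hy
    have h : (Finset.univ.filter fun j => x j ≤ y) ⊆ Finset.Iio i := fun j hj => by
      simp only [Finset.mem_filter, Finset.mem_univ, true_and] at hj
      exact Finset.mem_Iio.2 (hmono.lt_iff_lt.1 (hj.trans_lt hlt))
    have hc := Finset.card_le_card h
    rw [Fin.card_Iio] at hc
    have hc' : ((Finset.univ.filter fun j => x j ≤ y).card : ℝ) ≤ (i : ℕ) := by exact_mod_cast hc
    have := ht.1.trans_le (hy.trans (div_le_div_of_nonneg_right hc' hn.le))
    exact lt_irrefl _ this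

lemma optimalShift_circleEmpirical {n : ℕ} {x : Fin n → ℝ} (hx : ∀ i, x i ∈ Ico (0 : ℝ) 1) :
    optimalShift (circleEmpirical x) = (1 / (n : ℝ)) * ∑ i, x i - 1 / 2 := by
  rw [optimalShift, circleEmpirical, integral_smul_measure,
    integral_finsetSum_measure fun i _ => integrable_circleCoord _]
  have h : ∀ i, ∫ z, circleCoord z ∂(Measure.dirac (x i : UnitAddCircle)) = x i := fun i => by
    rw [integral_dirac' _ _ measurable_circleCoord.stronglyMeasurable, circleCoord_coe (hx i)]
  simp only [h, ENNReal.toReal_inv, ENNReal.toReal_natCast, smul_eq_mul, one_div]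

lemma integral_sub_sub_sq (c α a b : ℝ) :
    ∫ t in a..b, |c - t - α| ^ 2 = c ^ 2 * (b - a) - c * ((b + α) ^ 2 - (a + α) ^ 2) +
      ((b + α) ^ 3 - (a + α) ^ 3) / 3 := by
  have h : ∀ t : ℝ, |c - t - α| ^ 2 = ((fun s : ℝ => s ^ 2) ((c - α) - t)) := fun t => by
    rw [sq_abs]; ring
  simp only [h]
  rw [intervalIntegral.integral_comp_sub_left (fun s : ℝ => s ^ 2), integral_pow]
  push_cast
  ring

lemma integral_circleQuantile_circleEmpirical {n : ℕ} (hn : 1 ≤ n) {x : Fin n → ℝ}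
    (hx : ∀ i, x i ∈ Ico (0 : ℝ) 1) (hmono : StrictMono x) (α : ℝ) :
    ∫ t in (0 : ℝ)..1, |circleQuantile (circleEmpirical x) t - t - α| ^ 2 =
      (1 / (n : ℝ)) * ∑ i, x i ^ 2 - (2 * α / n) * ∑ i, x i -
        (1 / (n : ℝ) ^ 2) * ∑ i : Fin n, (2 * (i : ℝ) + 1) * x i + ((1 + α) ^ 3 - α ^ 3) / 3 := by
  have := isProbabilityMeasure_circleEmpirical hn x
  have hn0 : (0 : ℝ) < n := by exact_mod_cast hn
  set f : ℝ → ℝ := fun t => |circleQuantile (circleEmpirical x) t - t - α| ^ 2 with hf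
  have hint := intervalIntegrable_abs_circleQuantile_sub_sq (circleEmpirical x) α
  have hmem : ∀ k : ℕ, k ≤ n → (k : ℝ) / n ∈ uIcc (0 : ℝ) 1 := fun k hk => by
    rw [uIcc_of_le zero_le_one]
    exact ⟨by positivity, (div_le_one hn0).2 (by exact_mod_cast hk)⟩
  have hsum := intervalIntegral.sum_integral_adjacent_intervals (μ := volume) (f := f)
    (a := fun k : ℕ => (k : ℝ) / n) (n := n) fun k hk =>
      hint.mono_set (uIcc_subset_uIcc (hmem k hk.le) (hmem (k + 1) hk))
  simp only [Nat.cast_zero, zero_div, div_self hn0.ne'] at hsum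
  have hpiece : ∀ i : Fin n, ∫ t in ((i : ℕ) : ℝ) / n..((i + 1 : ℕ) : ℝ) / n, f t =
      (1 / (n : ℝ)) * x i ^ 2 - (2 * α / n) * x i - (1 / (n : ℝ) ^ 2) * ((2 * (i : ℝ) + 1) * x i) +
        ((((i + 1 : ℕ) : ℝ) / n + α) ^ 3 - (((i : ℕ) : ℝ) / n + α) ^ 3) / 3 := fun i => by
    have hle : ((i : ℕ) : ℝ) / n ≤ ((i + 1 : ℕ) : ℝ) / n := by gcongr; omega
    have hcongr : ∫ t in ((i : ℕ) : ℝ) / n..((i + 1 : ℕ) : ℝ) / n, f t =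
        ∫ t in ((i : ℕ) : ℝ) / n..((i + 1 : ℕ) : ℝ) / n, |x i - t - α| ^ 2 := by
      rw [intervalIntegral.integral_of_le hle, intervalIntegral.integral_of_le hle]
      refine setIntegral_congr_fun measurableSet_Ioc fun t ht => ?_
      push_cast at ht
      simp only [hf, circleQuantile_circleEmpirical hx hmono i ht]
    rw [hcongr, integral_sub_sub_sq]
    push_cast
    field_simp
    ring
  -- The part not involving the points telescopes.
  have htel : ∑ i : Fin n, ((((i + 1 : ℕ) : ℝ) / n + α) ^ 3 - (((i : ℕ) : ℝ) / n + α) ^ 3) / 3 =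
      ((1 + α) ^ 3 - α ^ 3) / 3 := by
    rw [← Finset.sum_div, Fin.sum_univ_eq_sum_range fun k : ℕ =>
      (((k + 1 : ℕ) : ℝ) / n + α) ^ 3 - ((k : ℝ) / n + α) ^ 3,
      Finset.sum_range_sub fun k : ℕ => ((k : ℝ) / n + α) ^ 3, div_self hn0.ne']
    simp
  rw [← hsum, ← Fin.sum_univ_eq_sum_range fun k : ℕ => ∫ t in (k : ℝ) / n..((k + 1 : ℕ) : ℝ) / n, f t]
  simp only [hpiece]
  rw [Finset.sum_add_distrib, htel, Finset.sum_sub_distrib, Finset.sum_sub_distrib,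
    Finset.mul_sum, Finset.mul_sum, Finset.mul_sum]

/-- Here `volume` on `UnitAddCircle = ℝ / ℤ` is the Haar measure of total mass one, that is the
uniform distribution, and the distance is the geodesic one, `min |x - y| (1 - |x - y|)` for
representatives in `[0, 1)`. Every probability measure on this compact space has finite moments.
The points are indexed from `0`, so the usual one-based index is `i + 1`. -/
theorem proposition1 :
    (∀ (μ : Measure UnitAddCircle) [IsProbabilityMeasure μ],
      Integrable circleCoord μ ∧
      IntervalIntegrable (fun t => |circleQuantile μ t - t - optimalShift μ| ^ 2) volume 0 1 ∧
      wassersteinDist 2 μ (volume : Measure UnitAddCircle) ≠ ∞ ∧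
      (wassersteinDist 2 μ (volume : Measure UnitAddCircle)).toReal ^ 2 =
        ∫ t in (0 : ℝ)..1, |circleQuantile μ t - t - optimalShift μ| ^ 2 ∧
      (∀ α : ℝ, α ≠ optimalShift μ →
        shiftCost μ volume (optimalShift μ) < shiftCost μ volume α)) ∧
    (∀ (n : ℕ) (x : Fin n → ℝ), 1 ≤ n → (∀ i, x i ∈ Ico (0 : ℝ) 1) → StrictMono x →
      wassersteinDist 2 (circleEmpirical x) (volume : Measure UnitAddCircle) ≠ ∞ ∧
      (wassersteinDist 2 (circleEmpirical x) (volume : Measure UnitAddCircle)).toReal ^ 2 =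
        (1 / (n : ℝ)) * ∑ i, x i ^ 2 - ((1 / (n : ℝ)) * ∑ i, x i) ^ 2
          + (1 / (n : ℝ) ^ 2) * ∑ i : Fin n, ((n : ℝ) + 1 - 2 * (((i : ℕ) : ℝ) + 1)) * x i
          + 1 / 12) := by
  refine ⟨fun μ _ => ⟨integrable_circleCoord μ, intervalIntegrable_abs_circleQuantile_sub_sq μ _,
    wassersteinDist_two_volume_ne_top μ, toReal_wassersteinDist_two_volume_sq μ,
    fun α hα => shiftCost_optimalShift_lt μ hα⟩, fun n x hn hx hmono => ?_⟩
  have := isProbabilityMeasure_circleEmpirical hn x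
  refine ⟨wassersteinDist_two_volume_ne_top _, ?_⟩
  have hn0 : (n : ℝ) ≠ 0 := by exact_mod_cast (by omega : n ≠ 0)
  rw [toReal_wassersteinDist_two_volume_sq, integral_circleQuantile_circleEmpirical hn hx hmono,
    optimalShift_circleEmpirical hx]
  -- With `m` the mean of the points and `α = m - 1/2`, one has `-2αm = -2m² + m` and `((1 + α)³ -
  -- α³) / 3 = m² + 1/12`; the leftover `m` supplies the term `n * ∑ i, x i` here.
  have h : ∑ i : Fin n, ((n : ℝ) + 1 - 2 * (((i : ℕ) : ℝ) + 1)) * x i =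
      n * ∑ i, x i - ∑ i : Fin n, (2 * (i : ℝ) + 1) * x i := by
    rw [Finset.mul_sum, ← Finset.sum_sub_distrib]
    exact Finset.sum_congr rfl fun i _ => by ring
  rw [h]
  field_simp
  ring
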